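/- There is a universal constant $c>0$ such that for every $B\ge 1$ there exist probability measures $P$ and $Q$ on a common measurable space $\mathcal X$ with $B$-bounded likelihood ratio, that is, $Q$ has a density $\rho=dQ/dP$ with $\sup_{x}\rho(x)\le B$, and an orthonormal basis $\{\phi_j\}_{j\ge1}$ of $L^2(Q)$ (consisting of measurable real functions defined at every point of $\mathcal X$), with the following property. For a sequence $\mu_j\ge 0$ and $\delta>0$ put $d(\delta)=\min\{j\ge1:\mu_j\le\delta^2\}$; call $\{\mu_j\}_{j\ge1}$ regular if it is summable and there is a constant $C>0$ with $\sum_{j>d(\delta)}\mu_j\le C\,d(\delta)\,\delta^2$ for all $\delta>0$. Then for every regular sequence $\{\mu_j\}_{j\ge1}$ the kernel $K(x,x')=\sum_j\mu_j\phi_j(x)\phi_j(x')$ satisfies $\sup_x K(x,x)<\infty$, and for every sample size $n\ge1$ and noise level $\sigma>0$ with $\sigma^2B/n\le\max_j\mu_j$, $$\inf_{\hat f}\ \sup_{f^\star\in\mathcal B_{\mathcal H}(1)}\mathbb E\,\|\hat f-f^\star\|_{L^2(Q)}^2\ \ge\ c\,\inf_{\delta>0}\Big\{\delta^2+\sigma^2B\,\frac{d(\delta)}{n}\Big\}.$$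 Here $\mathcal B_{\mathcal H}(1)=\{f=\sum_j\theta_j\phi_j:\ \sum_j\theta_j^2/\mu_j\le1\}$ (with $\theta_j=0$ whenever $\mu_j=0$) is the unit ball of the reproducing kernel Hilbert space of $K$. The expectation is over $n$ observations $(x_i,\,f^\star(x_i)+w_i)$ with $x_i\sim P$ and $w_i\sim N(0,\sigma^2)$ all independent, and the infimum is over all measurable functions $\hat f$ of these observations. -/

import Mathlib

open MeasureTheory ProbabilityTheory
open scoped ENNReal NNReal

namespace CovariateShift

/-! Sequences indexed by `j ≥ 1` in the mathematics are indexed by `ℕ` here, the entry with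
index `j ≥ 1` being the value at `j - 1`. -/

/-- The source `P` and the target `Q` have a `B`-bounded likelihood ratio: `Q` has a density
`ρ = dQ/dP` with respect to `P`, and `ρ x ≤ B` for all `x`. -/
def BoundedLikelihoodRatio {X : Type*} [MeasurableSpace X] (P Q : Measure X) (B : ℝ) : Prop :=
  ∃ ρ : X → ℝ≥0∞, Measurable ρ ∧ Q = P.withDensity ρ ∧ ∀ x, ρ x ≤ ENNReal.ofReal B

/-- The functions `φ j : X → ℝ` are measurable and square integrable, and their classes form an
orthonormal basis of the real Hilbert space `L²(Q)`. The functions are defined at every point,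
because they are also evaluated at points drawn from `P`, which can have atoms outside the
support of `Q`. -/
def IsOrthonormalBasisL2 {X : Type*} [MeasurableSpace X] (Q : Measure X) (φ : ℕ → X → ℝ) : Prop :=
  (∀ j, Measurable (φ j)) ∧
  ∃ h : ∀ j, MemLp (φ j) 2 Q,
    Orthonormal ℝ (fun j => (h j).toLp (φ j)) ∧
    (Submodule.span ℝ (Set.range fun j => (h j).toLp (φ j))).topologicalClosure = ⊤

/-- `d(δ) = min {j ≥ 1 | μ_j ≤ δ²}`. -/
noncomputable def statDim (μ : ℕ → ℝ) (δ : ℝ) : ℕ :=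
  sInf {j : ℕ | 1 ≤ j ∧ μ (j - 1) ≤ δ ^ 2}

/-- A regular sequence of eigenvalues: nonnegative, summable, and, for some constant `C`,
`∑_{j > d(δ)} μ_j ≤ C d(δ) δ²` for all `δ > 0`. (Entry number `d(δ) + 1 + k` of the sequence is
`μ (d(δ) + k)`.) -/
def IsRegular (μ : ℕ → ℝ) : Prop :=
  (∀ j, 0 ≤ μ j) ∧ Summable μ ∧
  ∃ C : ℝ, 0 < C ∧ ∀ δ : ℝ, 0 < δ →
    ∑' k : ℕ, μ (statDim μ δ + k) ≤ C * statDim μ δ * δ ^ 2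

/-- The kernel `K(x, x') = ∑_j μ_j φ_j(x) φ_j(x')` is uniformly bounded: the series `K(x, x)`
converges at every `x`, and `sup_x K(x, x) ≤ κ²` for a finite `κ > 0`. -/
def HasBoundedKernel {X : Type*} (φ : ℕ → X → ℝ) (μ : ℕ → ℝ) : Prop :=
  ∃ κ : ℝ, 0 < κ ∧ ∀ x, Summable (fun j => μ j * φ j x * φ j x) ∧
    ∑' j, μ j * φ j x * φ j x ≤ κ ^ 2

/-- The unit ball of the reproducing kernel Hilbert space: all functions `f = ∑_j θ_j φ_j`
(pointwise convergence) with `∑_j θ_j² / μ_j ≤ 1`. In `ℝ≥0∞`, `0 / 0 = 0` and `a / 0 = ∞` for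
`a ≠ 0`, so that `θ_j = 0` whenever `μ_j = 0`. -/
def unitBall {X : Type*} (φ : ℕ → X → ℝ) (μ : ℕ → ℝ) : Set (X → ℝ) :=
  {f | ∃ θ : ℕ → ℝ, (∀ x, HasSum (fun j => θ j * φ j x) (f x)) ∧
    ∑' j, ENNReal.ofReal (θ j ^ 2) / ENNReal.ofReal (μ j) ≤ 1}

/-- An estimator based on `n` observations `(x_i, y_i)`: a jointly measurable map which sends the
data to a function on `X`. -/
def Estimator (X : Type*) [MeasurableSpace X] (n : ℕ) : Type _ :=
  {g : (Fin n → X × ℝ) → X → ℝ // Measurable (Function.uncurry g)}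

/-- The risk `𝔼 ‖g(data) - f‖²_{L²(Q)}` of the estimator `g` when the data are
`(x_i, f(x_i) + w_i)`, `i = 1, …, n`, where the `x_i ∼ P` and the `w_i ∼ N(0, σ²)` are all
independent. -/
noncomputable def risk {X : Type*} [MeasurableSpace X] (P Q : Measure X) (σ : ℝ≥0) {n : ℕ}
    (g : Estimator X n) (f : X → ℝ) : ℝ≥0∞ :=
  ∫⁻ z : Fin n → X × ℝ,
    (∫⁻ x, ENNReal.ofReal ((g.1 (fun i => ((z i).1, f (z i).1 + (z i).2)) x - f x) ^ 2) ∂Q)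
    ∂(Measure.pi fun _ : Fin n => P.prod (gaussianReal 0 (σ ^ 2)))

/-- The minimax risk over a class `F` of regression functions: infimum over all estimators of the
supremum over `f ∈ F` of the risk. -/
noncomputable def minimaxRisk {X : Type*} [MeasurableSpace X] (P Q : Measure X) (σ : ℝ≥0) (n : ℕ)
    (F : Set (X → ℝ)) : ℝ≥0∞ :=
  ⨅ g : Estimator X n, ⨆ f ∈ F, risk P Q σ g f

end CovariateShift

namespace CovariateShift

/-! The source is made almost uninformative: `P` equals `Q` with weight `1 / B` and otherwise sits
at a point where every basis function vanishes. An observation then carries signal only with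
probability `1 / B`, so `∫ φ_j² dP = 1 / B` and the effective sample size is `n / B`. The target `Q`
is uniform on `[0, π]` with the cosine basis; its uniform bound keeps the kernel bounded for every
summable `μ`, so one basis serves all sequences.

The lower bound is Assouad's argument on the cube `∑_{j ∈ S} ± ε φ_j`. Neighbours differ by `2 ε
φ_i`, at squared `L²(P)` distance `4 ε² / B`. If `ε² ≤ σ² B / n`, their sample laws have Hellinger
affinity at least `1 / 2` (`half_le_lintegral_sampleRoot_mul`), so no sign can be estimated reliably
(`two_point_bound`). Bessel's inequality splits the `L²(Q)` loss into coordinates, and averaging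
over the cube gives risk at least `|S| ε² / 4` (`exists_le_risk_signSum`). The cube lies in the
ellipsoid when `|S| ε² ≤ μ_j` on `S`.

It remains to choose `S` and `ε` (`le_minimaxRisk`). Let `L` be the infimum on the right and `δ² = L
/ 4`. The first `d(δ) - 1` eigenvalues exceed `L / 4`, while `L ≤ δ² + (σ² B / n) d(δ)` makes `d(δ)`
large enough for a cube with `|S| ε² ≥ L / 4`. If `d(δ) ≤ 1`, a single coordinate with `μ_j ≥ σ² B /
n` suffices. -/

/-! ### Densities of the sample laws and their Hellinger affinity. -/

lemma lintegral_pi_fin_prod {X : Type*} [MeasurableSpace X] {n : ℕ} (m : Fin n → Measure X)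
    [∀ i, SigmaFinite (m i)] {p : X → ℝ≥0∞} (hp : Measurable p) :
    ∫⁻ z, ∏ i, p (z i) ∂(Measure.pi m) = ∏ i, ∫⁻ x, p x ∂(m i) := by
  induction n with
  | zero => simp
  | succ n ih =>
    have h := (measurePreserving_piFinSuccAbove m 0).symm
    have hmeas : Measurable fun z : Fin (n + 1) → X => ∏ i, p (z i) :=
      Finset.measurable_prod _ fun i _ => hp.comp (measurable_pi_apply i)
    have hmeas' : Measurable fun z : Fin n → X => ∏ i, p (z i) :=
      Finset.measurable_prod _ fun i _ => hp.comp (measurable_pi_apply i)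
    rw [← h.map_eq, lintegral_map hmeas (MeasurableEquiv.measurable _)]
    simp_rw [MeasurableEquiv.piFinSuccAbove_symm_apply, Fin.insertNthEquiv,
      Fin.prod_univ_succ, Equiv.coe_fn_mk, Fin.insertNth_zero, Fin.cons_zero, Fin.cons_succ]
    simp only [Fin.zero_succAbove]
    rw [← ih fun i => m i.succ]
    exact lintegral_prod_mul hp.aemeasurable hmeas'.aemeasurable

lemma pi_withDensity {X : Type*} [MeasurableSpace X] {n : ℕ} (m : Measure X) [SigmaFinite m]
    {p : X → ℝ≥0∞} (hp : Measurable p) [SigmaFinite (m.withDensity p)] :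
    Measure.pi (fun _ : Fin n => m.withDensity p) =
      (Measure.pi fun _ : Fin n => m).withDensity fun z => ∏ i, p (z i) := by
  refine Measure.pi_eq fun s hs => ?_
  -- Restricting to a rectangle gives a product of different restrictions, hence the varying factors
  -- in `lintegral_pi_fin_prod`.
  rw [withDensity_apply _ (MeasurableSet.univ_pi hs), Measure.restrict_pi_pi,
    lintegral_pi_fin_prod _ hp]
  exact Finset.prod_congr rfl fun i _ => (withDensity_apply _ (hs i)).symm

/-- The square root of the Lebesgue density of the Gaussian law. -/
noncomputable def gaussianRoot (a : ℝ) (v : ℝ≥0) (y : ℝ) : ℝ≥0∞ :=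
  ENNReal.ofReal (Real.sqrt (gaussianPDFReal a v y))

lemma gaussianRoot_sq (a : ℝ) (v : ℝ≥0) (y : ℝ) : gaussianRoot a v y ^ 2 = gaussianPDF a v y := by
  rw [gaussianRoot, gaussianPDF, ← ENNReal.ofReal_pow (Real.sqrt_nonneg _),
    Real.sq_sqrt (gaussianPDFReal_nonneg a v y)]

lemma measurable_gaussianRoot {X : Type*} [MeasurableSpace X] {f : X → ℝ} (hf : Measurable f)
    (v : ℝ≥0) : Measurable fun z : X × ℝ => gaussianRoot (f z.1) v z.2 := by
  unfold gaussianRoot gaussianPDFReal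
  fun_prop

/-- Completing the square, `(y - a)² + (y - b)² = 2 (y - (a + b) / 2)² + (a - b)² / 2`, turns the
integrand into a constant times the Gaussian density centred at the midpoint. -/
lemma lintegral_gaussianRoot_mul (a b : ℝ) {v : ℝ≥0} (hv : v ≠ 0) :
    ∫⁻ y, gaussianRoot a v y * gaussianRoot b v y =
      ENNReal.ofReal (Real.exp (-((a - b) ^ 2 / (8 * v)))) := by
  have hv' : (v : ℝ) ≠ 0 := by exact_mod_cast hv
  have key : ∀ y, gaussianRoot a v y * gaussianRoot b v y =
      ENNReal.ofReal (Real.exp (-((a - b) ^ 2 / (8 * v)))) * gaussianPDF ((a + b) / 2) v y := by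
    intro y
    rw [gaussianRoot, gaussianRoot, gaussianPDF, ← ENNReal.ofReal_mul (Real.sqrt_nonneg _),
      ← ENNReal.ofReal_mul (Real.exp_nonneg _), ← Real.sqrt_mul (gaussianPDFReal_nonneg a v y)]
    congr 1
    refine (Real.sqrt_eq_iff_mul_self_eq (mul_nonneg (gaussianPDFReal_nonneg a v y)
      (gaussianPDFReal_nonneg b v y)) (mul_nonneg (Real.exp_nonneg _)
      (gaussianPDFReal_nonneg _ v y))).2 ?_
    unfold gaussianPDFReal
    have h : Real.exp (-((a - b) ^ 2 / (8 * v))) * Real.exp (-(y - (a + b) / 2) ^ 2 / (2 * v)) *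
        (Real.exp (-((a - b) ^ 2 / (8 * v))) * Real.exp (-(y - (a + b) / 2) ^ 2 / (2 * v))) =
        Real.exp (-(y - a) ^ 2 / (2 * v)) * Real.exp (-(y - b) ^ 2 / (2 * v)) := by
      simp_rw [← Real.exp_add]
      congr 1
      field_simp
      ring
    linear_combination (-(√(2 * Real.pi * v))⁻¹ ^ 2) * h
  simp_rw [key]
  rw [lintegral_const_mul _ (measurable_gaussianPDF _ _), lintegral_gaussianPDF_eq_one _ hv,
    mul_one]

/-- The law of one observation has the Gaussian density with respect to `P ⊗ volume`. -/
lemma map_shift_eq_withDensity {X : Type*} [MeasurableSpace X] (P : Measure X)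
    [IsProbabilityMeasure P] {f : X → ℝ} (hf : Measurable f) {v : ℝ≥0} (hv : v ≠ 0) :
    (P.prod (gaussianReal 0 v)).map (fun z : X × ℝ => (z.1, f z.1 + z.2)) =
      (P.prod volume).withDensity fun z => gaussianRoot (f z.1) v z.2 ^ 2 := by
  have hT : Measurable fun z : X × ℝ => (z.1, f z.1 + z.2) := by fun_prop
  ext s hs
  rw [Measure.map_apply hT hs, Measure.prod_apply (hT hs), withDensity_apply _ hs,
    ← lintegral_indicator hs, lintegral_prod _
      (((measurable_gaussianRoot hf v).pow_const 2).indicator hs).aemeasurable]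
  refine lintegral_congr fun x => ?_
  have h1 : gaussianReal 0 v (Prod.mk x ⁻¹' ((fun z : X × ℝ => (z.1, f z.1 + z.2)) ⁻¹' s)) =
      gaussianReal (f x) v (Prod.mk x ⁻¹' s) := by
    have := gaussianReal_map_const_add (μ := 0) (v := v) (f x)
    rw [zero_add] at this
    rw [← this, Measure.map_apply (by fun_prop) (measurable_prodMk_left hs)]
    rfl
  rw [h1, gaussianReal_apply _ hv, ← lintegral_indicator (measurable_prodMk_left hs)]
  refine lintegral_congr fun y => ?_
  simp only [Set.indicator, gaussianRoot_sq]
  rfl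

/-- The square root of the joint density of the `n` observations. -/
noncomputable def sampleRoot {X : Type*} {n : ℕ} (f : X → ℝ) (v : ℝ≥0) (z : Fin n → X × ℝ) :
    ℝ≥0∞ :=
  ∏ i, gaussianRoot (f (z i).1) v (z i).2

lemma measurable_sampleRoot {X : Type*} [MeasurableSpace X] {n : ℕ} {f : X → ℝ}
    (hf : Measurable f) (v : ℝ≥0) : Measurable (sampleRoot (n := n) f v) :=
  Finset.measurable_prod _ fun i _ =>
    (measurable_gaussianRoot hf v).comp (measurable_pi_apply i)

/-- The change of variables moves the dependence on `f` from the data into a density with respect to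
one fixed measure, so that risks under different `f` become comparable. -/
lemma lintegral_shift_eq {X : Type*} [MeasurableSpace X] (P : Measure X)
    [IsProbabilityMeasure P] {f : X → ℝ} (hf : Measurable f) {v : ℝ≥0} (hv : v ≠ 0) {n : ℕ}
    {F : (Fin n → X × ℝ) → ℝ≥0∞} (hF : Measurable F) :
    ∫⁻ z, F (fun i => ((z i).1, f (z i).1 + (z i).2))
        ∂(Measure.pi fun _ : Fin n => P.prod (gaussianReal 0 v)) =
      ∫⁻ z, F z * sampleRoot f v z ^ 2 ∂(Measure.pi fun _ : Fin n => P.prod volume) := by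
  have hT : Measurable fun z : X × ℝ => (z.1, f z.1 + z.2) := by fun_prop
  have hp : Measurable fun z : X × ℝ => gaussianRoot (f z.1) v z.2 ^ 2 :=
    (measurable_gaussianRoot hf v).pow_const 2
  have hprod : Measurable fun z : Fin n → X × ℝ =>
      ∏ i, gaussianRoot (f (z i).1) v (z i).2 ^ 2 :=
    Finset.measurable_prod _ fun i _ => hp.comp (measurable_pi_apply i)
  have hmap := map_shift_eq_withDensity P hf hv
  have : IsProbabilityMeasure ((P.prod volume).withDensity fun z : X × ℝ =>
      gaussianRoot (f z.1) v z.2 ^ 2) := by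
    rw [← hmap]
    exact Measure.isProbabilityMeasure_map hT.aemeasurable
  have hmap' : IsProbabilityMeasure ((P.prod (gaussianReal 0 v)).map
      (fun z : X × ℝ => (z.1, f z.1 + z.2))) := Measure.isProbabilityMeasure_map hT.aemeasurable
  have hpi := Measure.pi_map_pi (μ := fun _ : Fin n => P.prod (gaussianReal 0 v))
    (f := fun _ => fun z : X × ℝ => (z.1, f z.1 + z.2)) (fun _ => hT.aemeasurable)
  rw [← lintegral_map (g := fun z : Fin n → X × ℝ => fun i => ((z i).1, f (z i).1 + (z i).2)) hF
    (measurable_pi_lambda _ fun i => hT.comp (measurable_pi_apply i)), hpi]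
  simp_rw [hmap]
  rw [pi_withDensity _ hp, lintegral_withDensity_eq_lintegral_mul _ hprod hF]
  refine lintegral_congr fun z => ?_
  rw [Pi.mul_apply, mul_comm, sampleRoot, Finset.prod_pow]

lemma lintegral_sampleRoot_sq {X : Type*} [MeasurableSpace X] (P : Measure X)
    [IsProbabilityMeasure P] {f : X → ℝ} (hf : Measurable f) {v : ℝ≥0} (hv : v ≠ 0) (n : ℕ) :
    ∫⁻ z, sampleRoot f v z ^ 2 ∂(Measure.pi fun _ : Fin n => P.prod volume) = 1 := by
  simpa using (lintegral_shift_eq P hf hv (n := n) (F := fun _ => 1) measurable_const).symm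

/-- Two regression functions at mean square distance at most `4 v / n` have sample laws of
Hellinger affinity at least `1 / 2`. -/
lemma half_le_lintegral_sampleRoot_mul {X : Type*} [MeasurableSpace X] (P : Measure X)
    [IsProbabilityMeasure P] {f g : X → ℝ} (hf : Measurable f) (hg : Measurable g) {v : ℝ≥0}
    (hv : v ≠ 0) {n : ℕ} (hn : 1 ≤ n)
    (hfg : ∫⁻ x, ENNReal.ofReal ((f x - g x) ^ 2) ∂P ≤ ENNReal.ofReal (4 * v / n)) :
    ENNReal.ofReal (1 / 2) ≤
      ∫⁻ z, sampleRoot f v z * sampleRoot g v z ∂(Measure.pi fun _ : Fin n => P.prod volume) := by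
  have hv' : (0 : ℝ) < v := by exact_mod_cast pos_iff_ne_zero.2 hv
  have hn' : (1 : ℝ) ≤ n := by exact_mod_cast hn
  have hm : Measurable fun z : X × ℝ => gaussianRoot (f z.1) v z.2 * gaussianRoot (g z.1) v z.2 :=
    (measurable_gaussianRoot hf v).mul (measurable_gaussianRoot hg v)
  simp_rw [sampleRoot, ← Finset.prod_mul_distrib]
  rw [lintegral_pi_fin_prod _ hm, Finset.prod_const, Finset.card_univ, Fintype.card_fin,
    lintegral_prod _ hm.aemeasurable]
  simp_rw [lintegral_gaussianRoot_mul _ _ hv]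
  -- By `exp (-t) ≥ 1 - t`, one observation loses at most the mean of `t = (f - g)² / (8 v)`, which
  -- is at most `(4 v / n) / (8 v) = 1 / (2 n)`.
  have h1 : ENNReal.ofReal (1 - 1 / (2 * n)) ≤
      ∫⁻ x, ENNReal.ofReal (Real.exp (-((f x - g x) ^ 2 / (8 * v)))) ∂P := by
    rw [ENNReal.ofReal_sub _ (by positivity), tsub_le_iff_right]
    calc ENNReal.ofReal 1 = ∫⁻ _, 1 ∂P := by simp
      _ ≤ ∫⁻ x, (ENNReal.ofReal (Real.exp (-((f x - g x) ^ 2 / (8 * v)))) +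
            ENNReal.ofReal (1 / (8 * v)) * ENNReal.ofReal ((f x - g x) ^ 2)) ∂P := by
          refine lintegral_mono fun x => ?_
          rw [← ENNReal.ofReal_mul (by positivity), ← ENNReal.ofReal_add (Real.exp_nonneg _)
            (by positivity), ← ENNReal.ofReal_one]
          refine ENNReal.ofReal_le_ofReal ?_
          have := Real.add_one_le_exp (-((f x - g x) ^ 2 / (8 * v)))
          have e : 1 / (8 * (v : ℝ)) * (f x - g x) ^ 2 = (f x - g x) ^ 2 / (8 * v) := by ring
          rw [e]
          linarith
      _ = _ := by
          rw [lintegral_add_left (by fun_prop), lintegral_const_mul _ (by fun_prop)]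
      _ ≤ _ := by
          gcongr
          refine (mul_le_mul_right hfg _).trans ?_
          rw [← ENNReal.ofReal_mul (by positivity)]
          refine ENNReal.ofReal_le_ofReal (le_of_eq ?_)
          field_simp
          norm_num
  have h2n : 1 / (2 * (n : ℝ)) ≤ 1 / 2 := by
    apply one_div_le_one_div_of_le <;> linarith
  calc ENNReal.ofReal (1 / 2) ≤ ENNReal.ofReal ((1 - 1 / (2 * n)) ^ n) := by
        refine ENNReal.ofReal_le_ofReal ?_
        -- Bernoulli's inequality: the `n`-fold product keeps affinity at least `1 - n / (2 n)`.
        have := one_add_mul_le_pow (a := -(1 / (2 * (n : ℝ)))) (by linarith) n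
        rw [← sub_eq_add_neg] at this
        refine le_trans (le_of_eq ?_) this
        field_simp
        norm_num
    _ = ENNReal.ofReal (1 - 1 / (2 * n)) ^ n := ENNReal.ofReal_pow (by linarith) n
    _ ≤ _ := by gcongr

/-! ### The two-point bound. -/

/-- Le Cam's two-point bound for the squared error, in terms of square roots `r`, `q` of two
densities. -/
lemma two_point_bound {Z : Type*} [MeasurableSpace Z] {ν : Measure Z} {r q : Z → ℝ≥0∞}
    (hr : Measurable r) (hq : Measurable q) (hr1 : ∫⁻ z, r z ^ 2 ∂ν = 1)
    (hq1 : ∫⁻ z, q z ^ 2 ∂ν = 1) (hrq : ENNReal.ofReal (1 / 2) ≤ ∫⁻ z, r z * q z ∂ν)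
    {T : Z → ℝ} (hT : Measurable T) {a b ε : ℝ} (hε : 0 ≤ ε) (hab : |a - b| = 2 * ε) :
    ENNReal.ofReal (ε ^ 2 / 2) ≤
      ∫⁻ z, ENNReal.ofReal ((T z - a) ^ 2) * r z ^ 2 ∂ν +
      ∫⁻ z, ENNReal.ofReal ((T z - b) ^ 2) * q z ^ 2 ∂ν := by
  have cs : ∀ {c : ℝ} {s t : Z → ℝ≥0∞}, Measurable s → Measurable t → ∫⁻ z, t z ^ 2 ∂ν = 1 →
      ∫⁻ z, (ENNReal.ofReal |T z - c| * s z) * t z ∂ν ≤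
        (∫⁻ z, ENNReal.ofReal ((T z - c) ^ 2) * s z ^ 2 ∂ν) ^ (1 / 2 : ℝ) := by
    intro c s t hs ht ht1
    have h := ENNReal.lintegral_mul_le_Lp_mul_Lq ν Real.HolderConjugate.two_two
      (f := fun z => ENNReal.ofReal |T z - c| * s z) (g := t) (by fun_prop) ht.aemeasurable
    simp only [ENNReal.rpow_two, Pi.mul_apply] at h
    rw [ht1, ENNReal.one_rpow, mul_one] at h
    refine h.trans (le_of_eq ?_)
    congr 1
    refine lintegral_congr fun z => ?_
    rw [mul_pow, ← ENNReal.ofReal_pow (abs_nonneg _), sq_abs]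
  set A := ∫⁻ z, ENNReal.ofReal ((T z - a) ^ 2) * r z ^ 2 ∂ν
  set C := ∫⁻ z, ENNReal.ofReal ((T z - b) ^ 2) * q z ^ 2 ∂ν
  -- Integrate `2 ε ≤ |T - a| + |T - b|` against `r q`, then apply Cauchy–Schwarz to each term.
  -- Squaring gives `ε² ≤ 2 (A + C)`.
  have h1 : ENNReal.ofReal ε ≤ A ^ (1 / 2 : ℝ) + C ^ (1 / 2 : ℝ) := by
    calc ENNReal.ofReal ε = ENNReal.ofReal (2 * ε) * ENNReal.ofReal (1 / 2) := by
          rw [← ENNReal.ofReal_mul (by positivity)]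
          congr 1
          ring
      _ ≤ ENNReal.ofReal (2 * ε) * ∫⁻ z, r z * q z ∂ν := by gcongr
      _ = ∫⁻ z, ENNReal.ofReal (2 * ε) * (r z * q z) ∂ν := by
          rw [lintegral_const_mul _ (by fun_prop)]
      _ ≤ ∫⁻ z, ((ENNReal.ofReal |T z - a| * r z) * q z +
            (ENNReal.ofReal |T z - b| * q z) * r z) ∂ν := by
          refine lintegral_mono fun z => ?_
          have : ENNReal.ofReal (2 * ε) ≤ ENNReal.ofReal |T z - a| + ENNReal.ofReal |T z - b| := by
            rw [← ENNReal.ofReal_add (abs_nonneg _) (abs_nonneg _), ← hab, abs_sub_comm (T z) a]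
            exact ENNReal.ofReal_le_ofReal (abs_sub_le a (T z) b)
          calc _ ≤ (ENNReal.ofReal |T z - a| + ENNReal.ofReal |T z - b|) * (r z * q z) := by gcongr
            _ = _ := by ring
      _ = _ := lintegral_add_left (by fun_prop) _
      _ ≤ _ := add_le_add (cs hr hq hq1) (cs hq hr hr1)
  by_cases hA : A = ∞
  · simp [hA]
  by_cases hC : C = ∞
  · simp [hC]
  lift A to ℝ≥0 using hA with A'
  lift C to ℝ≥0 using hC with C'
  rw [← ENNReal.coe_rpow_of_nonneg _ (by norm_num), ← ENNReal.coe_rpow_of_nonneg _ (by norm_num),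
    ← ENNReal.coe_add, ENNReal.ofReal_le_iff_le_toReal ENNReal.coe_ne_top] at h1
  rw [← ENNReal.coe_add, ENNReal.ofReal_le_iff_le_toReal ENNReal.coe_ne_top]
  simp only [ENNReal.coe_toReal, NNReal.coe_add, NNReal.coe_rpow, ← Real.sqrt_eq_rpow] at h1 ⊢
  have hx := Real.sq_sqrt A'.coe_nonneg
  have hy := Real.sq_sqrt C'.coe_nonneg
  nlinarith [sq_nonneg (√(A' : ℝ) - √(C' : ℝ)), pow_le_pow_left₀ hε h1 2]

/-! ### Reduction of the `L²(Q)` loss to coordinates. -/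

lemma L2_inner_toLp {X : Type*} [MeasurableSpace X] {Q : Measure X} {f g : X → ℝ}
    (hf : MemLp f 2 Q) (hg : MemLp g 2 Q) :
    inner ℝ (hf.toLp f) (hg.toLp g) = ∫ x, f x * g x ∂Q := by
  rw [L2.inner_def]
  refine integral_congr_ae ?_
  filter_upwards [hf.coeFn_toLp, hg.coeFn_toLp] with x h1 h2
  rw [h1, h2, real_inner_eq_re_inner, RCLike.inner_apply]
  simp [mul_comm]

lemma ofReal_norm_toLp_sq {X : Type*} [MeasurableSpace X] {Q : Measure X} {f : X → ℝ}
    (hf : MemLp f 2 Q) :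
    ENNReal.ofReal (‖hf.toLp f‖ ^ 2) = ∫⁻ x, ENNReal.ofReal (f x ^ 2) ∂Q := by
  rw [← real_inner_self_eq_norm_sq, L2_inner_toLp hf hf,
    ← ofReal_integral_eq_lintegral_ofReal hf.integrable_sq
      (Filter.Eventually.of_forall fun x => sq_nonneg (f x))]
  simp_rw [sq]

lemma memLp_two_of_lintegral_ne_top {X : Type*} [MeasurableSpace X] {Q : Measure X} {f : X → ℝ}
    (hf : Measurable f) (h : ∫⁻ x, ENNReal.ofReal (f x ^ 2) ∂Q ≠ ∞) : MemLp f 2 Q := by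
  rw [memLp_two_iff_integrable_sq hf.aestronglyMeasurable]
  refine ⟨(hf.pow_const 2).aestronglyMeasurable, ?_⟩
  rw [hasFiniteIntegral_iff_ofReal (Filter.Eventually.of_forall fun x => sq_nonneg (f x))]
  exact lt_top_iff_ne_top.2 h

/-- Bessel's inequality for `g - ∑ a_i ψ_i`, valid also when `g` is not square integrable. -/
lemma bessel_lintegral {X ι : Type*} [MeasurableSpace X] [Fintype ι] {Q : Measure X}
    {ψ : ι → X → ℝ} (hm : ∀ i, Measurable (ψ i)) (hψ : ∀ i, MemLp (ψ i) 2 Q)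
    (ho : Orthonormal ℝ fun i => (hψ i).toLp (ψ i)) {g : X → ℝ} (hg : Measurable g) (a : ι → ℝ) :
    ∑ i, ENNReal.ofReal ((∫ x, ψ i x * g x ∂Q - a i) ^ 2) ≤
      ∫⁻ x, ENNReal.ofReal ((g x - ∑ i, a i * ψ i x) ^ 2) ∂Q := by
  classical
  -- An infinite loss makes the bound trivial, whatever default value the integrals of `ψ i * g`
  -- take. Otherwise the difference lies in `L²(Q)` and Bessel's inequality applies.
  by_cases htop : ∫⁻ x, ENNReal.ofReal ((g x - ∑ i, a i * ψ i x) ^ 2) ∂Q = ∞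
  · rw [htop]; exact le_top
  have hum : Measurable fun x => g x - ∑ i, a i * ψ i x :=
    hg.sub (Finset.measurable_sum _ fun i _ => (hm i).const_mul (a i))
  have hu : MemLp (fun x => g x - ∑ i, a i * ψ i x) 2 Q := memLp_two_of_lintegral_ne_top hum htop
  rw [← ofReal_norm_toLp_sq hu, ← ENNReal.ofReal_sum_of_nonneg fun i _ => sq_nonneg _]
  refine ENNReal.ofReal_le_ofReal ?_
  refine le_trans (le_of_eq ?_) (ho.sum_inner_products_le (s := Finset.univ) (hu.toLp _))
  refine Finset.sum_congr rfl fun i _ => ?_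
  rw [Real.norm_eq_abs, sq_abs, L2_inner_toLp]
  congr 1
  have hint : ∀ j, Integrable (fun x => ψ i x * (a j * ψ j x)) Q := fun j =>
    (hψ i).integrable_mul ((hψ j).const_mul (a j))
  have hsum : ∫ x, ∑ j, ψ i x * (a j * ψ j x) ∂Q = a i := by
    rw [integral_finsetSum _ fun j _ => hint j]
    have : ∀ j, ∫ x, ψ i x * (a j * ψ j x) ∂Q = if i = j then a j else 0 := by
      intro j
      have h1 := orthonormal_iff_ite.1 ho i j
      rw [L2_inner_toLp] at h1
      simp_rw [mul_left_comm (ψ i _) (a j)]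
      rw [integral_const_mul, h1]
      simp
    simp_rw [this]
    simp
  have hiu : Integrable (fun x => ψ i x * (g x - ∑ j, a j * ψ j x)) Q := (hψ i).integrable_mul hu
  have : ∫ x, ψ i x * g x ∂Q =
      ∫ x, (ψ i x * (g x - ∑ j, a j * ψ j x) + ∑ j, ψ i x * (a j * ψ j x)) ∂Q := by
    refine integral_congr_ae (Filter.Eventually.of_forall fun x => ?_)
    simp only [← Finset.mul_sum]
    ring
  rw [this, integral_add hiu (integrable_finsetSum _ fun j _ => hint j), hsum]
  ring

/-! ### The sign hypercube and Assouad's lemma. -/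

/-- The function `∑ ± ε ψ_i` with signs given by `v`. -/
noncomputable def signSum {X ι : Type*} [Fintype ι] (ψ : ι → X → ℝ) (ε : ℝ) (v : ι → Bool)
    (x : X) : ℝ :=
  ∑ i, (if v i then ε else -ε) * ψ i x

lemma measurable_signSum {X ι : Type*} [MeasurableSpace X] [Fintype ι] {ψ : ι → X → ℝ}
    (hm : ∀ i, Measurable (ψ i)) (ε : ℝ) (v : ι → Bool) : Measurable (signSum ψ ε v) :=
  Finset.measurable_sum _ fun i _ => (hm i).const_mul _

/-- The bijection of sign vectors which changes the sign of entry `i`. -/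
def flipSign {ι : Type*} [DecidableEq ι] (i : ι) : (ι → Bool) ≃ (ι → Bool) :=
  Function.Involutive.toPerm (fun v => Function.update v i (!v i)) fun v => by simp

lemma flipSign_apply {ι : Type*} [DecidableEq ι] (i : ι) (v : ι → Bool) :
    flipSign i v = Function.update v i (!v i) := rfl

lemma signSum_sub_flipSign_sq {X ι : Type*} [Fintype ι] [DecidableEq ι] (ψ : ι → X → ℝ) (ε : ℝ)
    (v : ι → Bool) (i : ι) (x : X) :
    (signSum ψ ε v x - signSum ψ ε (flipSign i v) x) ^ 2 = 4 * ε ^ 2 * ψ i x ^ 2 := by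
  rw [signSum, signSum, ← Finset.sum_sub_distrib, Finset.sum_eq_single i]
  · rw [flipSign_apply, Function.update_self]
    cases v i <;> simp <;> ring
  · intro j _ hj
    rw [flipSign_apply, Function.update_of_ne hj, sub_self]
  · simp

/-- Assouad's lemma for the regression model under covariate shift. -/
lemma exists_le_risk_signSum {X ι : Type*} [MeasurableSpace X] [Fintype ι]
    {P Q : Measure X} [IsProbabilityMeasure P] [IsProbabilityMeasure Q] {B : ℝ} (hB : 0 < B)
    {ψ : ι → X → ℝ} (hm : ∀ i, Measurable (ψ i)) (hψ : ∀ i, MemLp (ψ i) 2 Q)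
    (ho : Orthonormal ℝ fun i => (hψ i).toLp (ψ i))
    (hP : ∀ i, ∫⁻ x, ENNReal.ofReal (ψ i x ^ 2) ∂P ≤ ENNReal.ofReal (1 / B))
    {n : ℕ} (hn : 1 ≤ n) {σ : ℝ≥0} (hσ : 0 < σ) {ε : ℝ} (hε : 0 ≤ ε)
    (hεs : ε ^ 2 ≤ (σ : ℝ) ^ 2 * B / n) (g : Estimator X n) :
    ∃ v : ι → Bool,
      ENNReal.ofReal (Fintype.card ι * ε ^ 2 / 4) ≤ risk P Q σ g (signSum ψ ε v) := by
  classical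
  have hv : σ ^ 2 ≠ 0 := pow_ne_zero _ hσ.ne'
  set ν := Measure.pi fun _ : Fin n => P.prod (volume : Measure ℝ) with hν
  -- Any estimator of the function yields estimators of its coordinates; `R i v` is the risk of the
  -- `i`-th one at the vertex `v`.
  set T : ι → (Fin n → X × ℝ) → ℝ := fun i z => ∫ x, ψ i x * g.1 z x ∂Q with hT
  have hTm : ∀ i, Measurable (T i) := fun i => by
    have : Measurable (Function.uncurry fun (z : Fin n → X × ℝ) (x : X) => ψ i x * g.1 z x) :=
      ((hm i).comp measurable_snd).mul g.2
    exact this.stronglyMeasurable.integral_prod_right.measurable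
  set R : ι → (ι → Bool) → ℝ≥0∞ := fun i v =>
    ∫⁻ z, ENNReal.ofReal ((T i z - (if v i then ε else -ε)) ^ 2) *
      sampleRoot (signSum ψ ε v) (σ ^ 2) z ^ 2 ∂ν with hR
  have hrisk : ∀ v, ∑ i, R i v ≤ risk P Q σ g (signSum ψ ε v) := by
    intro v
    have hF : Measurable fun z : Fin n → X × ℝ =>
        ∑ i, ENNReal.ofReal ((T i z - (if v i then ε else -ε)) ^ 2) :=
      Finset.measurable_sum _ fun i _ => by have := hTm i; fun_prop
    have hs := measurable_sampleRoot (n := n) (measurable_signSum hm ε v) (σ ^ 2)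
    calc ∑ i, R i v = ∫⁻ z, (∑ i, ENNReal.ofReal ((T i z - (if v i then ε else -ε)) ^ 2)) *
          sampleRoot (signSum ψ ε v) (σ ^ 2) z ^ 2 ∂ν := by
          simp_rw [Finset.sum_mul]
          rw [lintegral_finsetSum]
          intro i _
          have := hTm i
          fun_prop
      _ = _ := (lintegral_shift_eq P (measurable_signSum hm ε v) hv hF).symm
      _ ≤ _ := lintegral_mono fun z => by
          refine bessel_lintegral hm hψ ho ?_ _
          exact g.2.comp measurable_prodMk_left
  have hpair : ∀ i v, ENNReal.ofReal (ε ^ 2 / 2) ≤ R i v + R i (flipSign i v) := by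
    intro i v
    have hf := measurable_signSum hm ε v
    have hf' := measurable_signSum hm ε (flipSign i v)
    refine two_point_bound (measurable_sampleRoot hf _) (measurable_sampleRoot hf' _)
      (lintegral_sampleRoot_sq P hf hv n) (lintegral_sampleRoot_sq P hf' hv n)
      (half_le_lintegral_sampleRoot_mul P hf hf' hv hn ?_) (hTm i) hε ?_
    · simp_rw [signSum_sub_flipSign_sq, ENNReal.ofReal_mul (show 0 ≤ 4 * ε ^ 2 by positivity)]
      have := hm i
      rw [lintegral_const_mul _ (by fun_prop)]
      refine (mul_le_mul_right (hP i) _).trans ?_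
      rw [← ENNReal.ofReal_mul (by positivity)]
      refine ENNReal.ofReal_le_ofReal ?_
      calc 4 * ε ^ 2 * (1 / B) ≤ 4 * ((σ : ℝ) ^ 2 * B / n) * (1 / B) := by gcongr
        _ = _ := by push_cast; field_simp
    · rw [flipSign_apply, Function.update_self]
      have : |ε + ε| = 2 * ε := by rw [abs_of_nonneg (by positivity)]; ring
      cases v i
      · rw [← abs_neg] at this
        simpa [neg_add_rev, sub_eq_add_neg] using this
      · simpa using this
  -- The worst vertex has risk at least the average over the cube. In the sum over all vertices each
  -- flip is a bijection, so the paired risks count every `R i v` twice.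
  obtain ⟨w, hw⟩ := Finite.exists_max fun v => risk P Q σ g (signSum ψ ε v)
  refine ⟨w, ?_⟩
  set N : ℝ≥0∞ := (Fintype.card (ι → Bool) : ℝ≥0∞) with hN
  have h1 : N * ((Fintype.card ι : ℝ≥0∞) * ENNReal.ofReal (ε ^ 2 / 2)) ≤
      N * (2 * risk P Q σ g (signSum ψ ε w)) := by
    calc N * ((Fintype.card ι : ℝ≥0∞) * ENNReal.ofReal (ε ^ 2 / 2))
        = ∑ i : ι, ∑ _v : ι → Bool, ENNReal.ofReal (ε ^ 2 / 2) := by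
          simp only [Finset.sum_const, Finset.card_univ, nsmul_eq_mul, hN]
          ring
      _ ≤ ∑ i, ∑ v, (R i v + R i (flipSign i v)) :=
          Finset.sum_le_sum fun i _ => Finset.sum_le_sum fun v _ => hpair i v
      _ = 2 * ∑ i, ∑ v, R i v := by
          simp_rw [Finset.sum_add_distrib, two_mul]
          congr 1
          exact Finset.sum_congr rfl fun i _ => (flipSign i).sum_comp (R i)
      _ = 2 * ∑ v, ∑ i, R i v := by rw [Finset.sum_comm]
      _ ≤ 2 * ∑ _v : ι → Bool, risk P Q σ g (signSum ψ ε w) := by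
          gcongr with v
          exact (hrisk v).trans (hw v)
      _ = _ := by
          simp only [Finset.sum_const, Finset.card_univ, nsmul_eq_mul, hN]
          ring
  have h2 := (ENNReal.mul_le_mul_iff_right (by simp)
    (ENNReal.natCast_ne_top _)).1 h1
  refine (ENNReal.mul_le_mul_iff_right (two_ne_zero) ENNReal.ofNat_ne_top).1 (le_trans ?_ h2)
  rw [← ENNReal.ofReal_natCast, ← ENNReal.ofReal_mul (by positivity),
    show (2 : ℝ≥0∞) = ENNReal.ofReal 2 by simp, ← ENNReal.ofReal_mul (by positivity)]
  exact ENNReal.ofReal_le_ofReal (le_of_eq (by ring))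

/-! ### Cubes in the ellipsoid and the choice of dimension. -/

/-- Each of the `|S|` nonzero coordinates contributes `ε² / μ_j ≤ 1 / |S|` to the ellipsoid sum. -/
lemma signSum_mem_unitBall {X : Type*} {φ : ℕ → X → ℝ} {μ : ℕ → ℝ} {ε : ℝ}
    {S : Finset ℕ} (hε : 0 < ε) (hS : ∀ j ∈ S, S.card * ε ^ 2 ≤ μ j) (v : S → Bool) :
    signSum (fun j : S => φ j) ε v ∈ unitBall φ μ := by
  classical
  refine ⟨fun j => if h : j ∈ S then (if v ⟨j, h⟩ then ε else -ε) else 0, fun x => ?_, ?_⟩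
  · have : signSum (fun j : S => φ j) ε v x = ∑ j ∈ S,
        (if h : j ∈ S then (if v ⟨j, h⟩ then ε else -ε) else 0) * φ j x := by
      rw [signSum, ← Finset.sum_attach S, Finset.univ_eq_attach]
      exact Finset.sum_congr rfl fun j _ => by simp
    rw [this]
    exact hasSum_sum_of_ne_finset_zero fun j hj => by simp [hj]
  · rw [tsum_eq_sum (s := S) fun j hj => by simp [hj]]
    calc _ ≤ ∑ j ∈ S, (S.card : ℝ≥0∞)⁻¹ := by
          refine Finset.sum_le_sum fun j hj => ?_
          have hpos : 0 < S.card := Finset.card_pos.2 ⟨j, hj⟩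
          have hsq : (if h : j ∈ S then (if v ⟨j, h⟩ then ε else -ε) else 0) ^ 2 = ε ^ 2 := by
            rw [dif_pos hj]
            split_ifs <;> ring
          have hμ : 0 < μ j := lt_of_lt_of_le (by positivity) (hS j hj)
          rw [hsq, ← ENNReal.ofReal_natCast, ← ENNReal.ofReal_inv_of_pos (by positivity),
            ← ENNReal.ofReal_div_of_pos hμ]
          refine ENNReal.ofReal_le_ofReal ?_
          rw [div_le_iff₀ hμ, inv_mul_eq_div, le_div_iff₀ (by positivity), mul_comm]
          exact hS j hj
      _ ≤ 1 := by
          rw [Finset.sum_const, nsmul_eq_mul]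
          exact ENNReal.mul_inv_le_one _

/-- A hypercube of side `2 ε` inside the ellipsoid, in the coordinates of `S`, bounds the minimax
risk from below. -/
lemma le_minimaxRisk_of_finset {X : Type*} [MeasurableSpace X] {P Q : Measure X}
    [IsProbabilityMeasure P] [IsProbabilityMeasure Q] {B : ℝ} (hB : 0 < B) {φ : ℕ → X → ℝ}
    (hφ : IsOrthonormalBasisL2 Q φ)
    (hP : ∀ j, ∫⁻ x, ENNReal.ofReal (φ j x ^ 2) ∂P ≤ ENNReal.ofReal (1 / B))
    {n : ℕ} (hn : 1 ≤ n) {σ : ℝ≥0} (hσ : 0 < σ) {ε : ℝ} (hε : 0 < ε)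
    (hεs : ε ^ 2 ≤ (σ : ℝ) ^ 2 * B / n) {μ : ℕ → ℝ} {S : Finset ℕ}
    (hS : ∀ j ∈ S, S.card * ε ^ 2 ≤ μ j) :
    ENNReal.ofReal (S.card * ε ^ 2 / 4) ≤ minimaxRisk P Q σ n (unitBall φ μ) := by
  obtain ⟨hm, hL, ho, -⟩ := hφ
  refine le_iInf fun g => ?_
  obtain ⟨v, hv⟩ := exists_le_risk_signSum (ψ := fun j : S => φ j) hB (fun j => hm j)
    (fun j => hL j) (ho.comp _ Subtype.val_injective) (fun j => hP j) hn hσ hε.le hεs g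
  rw [Fintype.card_coe] at hv
  exact hv.trans (le_iSup₂_of_le _ (signSum_mem_unitBall hε hS v) le_rfl)

/-- The lower bound of the minimax risk in terms of the critical radius. -/
lemma le_minimaxRisk {X : Type*} [MeasurableSpace X] {P Q : Measure X}
    [IsProbabilityMeasure P] [IsProbabilityMeasure Q] {B : ℝ} (hB : 0 < B) {φ : ℕ → X → ℝ}
    (hφ : IsOrthonormalBasisL2 Q φ)
    (hP : ∀ j, ∫⁻ x, ENNReal.ofReal (φ j x ^ 2) ∂P ≤ ENNReal.ofReal (1 / B))
    {n : ℕ} (hn : 1 ≤ n) {σ : ℝ≥0} (hσ : 0 < σ) {μ : ℕ → ℝ}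
    (hμ : ∃ j, (σ : ℝ) ^ 2 * B / n ≤ μ j) :
    ENNReal.ofReal (1 / 16 * ⨅ δ : Set.Ioi (0 : ℝ),
        ((δ : ℝ) ^ 2 + (σ : ℝ) ^ 2 * B * (statDim μ δ / n))) ≤
      minimaxRisk P Q σ n (unitBall φ μ) := by
  set s := (σ : ℝ) ^ 2 * B / n with hs
  have hσ' : (0 : ℝ) < σ := by exact_mod_cast hσ
  have hn' : (0 : ℝ) < n := by exact_mod_cast hn
  have hs0 : 0 < s := by positivity
  have hform : ∀ δ : ℝ, (σ : ℝ) ^ 2 * B * (statDim μ δ / n) = s * statDim μ δ := fun δ => by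
    rw [hs]; ring
  simp_rw [hform]
  set L := ⨅ δ : Set.Ioi (0 : ℝ), ((δ : ℝ) ^ 2 + s * statDim μ δ) with hL
  have hbdd : BddBelow (Set.range fun δ : Set.Ioi (0 : ℝ) => (δ : ℝ) ^ 2 + s * statDim μ δ) :=
    ⟨0, by rintro _ ⟨δ, rfl⟩; positivity⟩
  rcases le_or_gt L 0 with hL0 | hL0
  · rw [ENNReal.ofReal_of_nonpos (by linarith)]
    exact zero_le
  -- Testing the infimum at `δ² = L / 4` gives `s d ≥ 3 L / 4`.
  have hδ : 0 < √(L / 4) := Real.sqrt_pos.2 (by positivity)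
  have hδsq : √(L / 4) ^ 2 = L / 4 := Real.sq_sqrt (by positivity)
  have hle : L ≤ L / 4 + s * statDim μ √(L / 4) := by
    have := ciInf_le hbdd ⟨√(L / 4), hδ⟩
    simpa only [hδsq] using this
  set d := statDim μ √(L / 4) with hd
  have hbound : ∀ {ε2 : ℝ} {S : Finset ℕ}, 0 < ε2 → ε2 ≤ s → (∀ j ∈ S, S.card * ε2 ≤ μ j) →
      L / 4 ≤ S.card * ε2 →
      ENNReal.ofReal (1 / 16 * L) ≤ minimaxRisk P Q σ n (unitBall φ μ) := by
    intro ε2 S h0 h1 h2 h3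
    have hsq : √ε2 ^ 2 = ε2 := Real.sq_sqrt h0.le
    have := le_minimaxRisk_of_finset hB hφ hP hn hσ (ε := √ε2) (Real.sqrt_pos.2 h0)
      (by rwa [hsq]) (S := S) (μ := μ) (by rwa [hsq])
    rw [hsq] at this
    exact le_trans (ENNReal.ofReal_le_ofReal (by linarith)) this
  -- For `d ≤ 1` there may be no eigenvalue above `δ²`; the noise condition supplies a coordinate
  -- with `μ_j ≥ s`, and `s ≥ 3 L / 4`.
  rcases le_or_gt d 1 with hd1 | hd1
  · obtain ⟨j, hj⟩ := hμ
    have : (d : ℝ) ≤ 1 := by exact_mod_cast hd1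
    refine hbound (S := {j}) hs0 le_rfl (by simpa using hj) ?_
    simp only [Finset.card_singleton, Nat.cast_one, one_mul]
    nlinarith
  · have hD : (1 : ℝ) ≤ ((d - 1 : ℕ) : ℝ) := by exact_mod_cast Nat.le_sub_one_of_lt hd1
    have hdD : (d : ℝ) = ((d - 1 : ℕ) : ℝ) + 1 := by
      rw [Nat.cast_sub hd1.le]; ring
    set D : ℝ := ((d - 1 : ℕ) : ℝ) with hDdef
    have hD0 : 0 < D := by linarith
    -- The two caps on `ε²` come from the ellipsoid and from indistinguishability. Since `D = d - 1
    -- ≥ d / 2`, one has `s D ≥ 3 L / 8`, so either cap gives `D ε² ≥ L / 4`.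
    refine hbound (S := Finset.range (d - 1)) (ε2 := min (L / 4 / D) s)
      (lt_min (by positivity) hs0) (min_le_right _ _) ?_ ?_
    · intro j hj
      rw [Finset.card_range, ← hDdef]
      have hlt : j + 1 < d := by have := Finset.mem_range.1 hj; omega
      -- The entry `μ j` has number `j + 1 < d`, so minimality of `d` gives `μ j > δ²`.
      have hnot := Nat.notMem_of_lt_sInf hlt
      simp only [Set.mem_ofPred_eq, not_and, not_le, Nat.add_sub_cancel] at hnot
      have := hnot (by omega)
      rw [hδsq] at this
      calc D * min (L / 4 / D) s ≤ D * (L / 4 / D) := by gcongr; exact min_le_left _ _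
        _ = L / 4 := by field_simp
        _ ≤ μ j := this.le
    · rw [Finset.card_range, ← hDdef]
      rcases min_cases (L / 4 / D) s with ⟨h, -⟩ | ⟨h, -⟩ <;> rw [h]
      · exact le_of_eq (by field_simp)
      · nlinarith

/-! ### The cosine basis of the target space. -/

/-- The uniform distribution on `[0, π]`. -/
noncomputable def uniformPi : Measure ℝ :=
  (ENNReal.ofReal Real.pi)⁻¹ • volume.restrict (Set.Icc 0 Real.pi)

/-- The cosine basis on `[0, π]`, extended by zero. -/
noncomputable def cosBasis (j : ℕ) : ℝ → ℝ :=
  (Set.Icc 0 Real.pi).indicator fun x => (if j = 0 then 1 else √2) * Real.cos (j * x)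

instance : IsProbabilityMeasure uniformPi where
  measure_univ := by
    rw [uniformPi, Measure.smul_apply, Measure.restrict_apply MeasurableSet.univ, Set.univ_inter,
      Real.volume_Icc, sub_zero, smul_eq_mul]
    exact ENNReal.inv_mul_cancel (ENNReal.ofReal_pos.2 Real.pi_pos).ne' ENNReal.ofReal_ne_top

lemma ae_mem_Icc_uniformPi : ∀ᵐ x ∂uniformPi, x ∈ Set.Icc 0 Real.pi :=
  Measure.ae_smul_measure (ae_restrict_mem measurableSet_Icc) _

lemma measurable_cosBasis (j : ℕ) : Measurable (cosBasis j) :=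
  Measurable.indicator (by fun_prop) measurableSet_Icc

lemma cosBasis_sq_le (j : ℕ) (x : ℝ) : cosBasis j x * cosBasis j x ≤ 2 := by
  unfold cosBasis
  by_cases hx : x ∈ Set.Icc 0 Real.pi
  · rw [Set.indicator_of_mem hx]
    have h1 := Real.cos_sq_le_one (j * x)
    have h2 : √2 ^ 2 = 2 := Real.sq_sqrt (by norm_num)
    split_ifs
    · nlinarith
    · nlinarith [sq_nonneg (Real.cos (j * x))]
  · rw [Set.indicator_of_notMem hx]
    norm_num

lemma abs_cosBasis_le (j : ℕ) (x : ℝ) : |cosBasis j x| ≤ 2 := by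
  have := cosBasis_sq_le j x
  exact abs_le_of_sq_le_sq (by nlinarith) (by norm_num)

lemma memLp_cosBasis (j : ℕ) : MemLp (cosBasis j) 2 uniformPi :=
  MemLp.of_bound (measurable_cosBasis j).aestronglyMeasurable 2
    (Filter.Eventually.of_forall fun x => abs_cosBasis_le j x)

lemma integral_cos_int_mul (m : ℤ) :
    ∫ x in (0 : ℝ)..Real.pi, Real.cos (m * x) = if m = 0 then Real.pi else 0 := by
  split_ifs with hm
  · simp [hm]
  · have hm' : (m : ℝ) ≠ 0 := by exact_mod_cast hm
    rw [intervalIntegral.integral_comp_mul_left _ hm', integral_cos, Real.sin_int_mul_pi]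
    simp

/-- Product-to-sum leaves cosines of frequencies `i - j` and `i + j`. The second frequency vanishes
only for `i = j = 0`, which is why the constant function is normalised differently. -/
lemma integral_cosBasis_mul (i j : ℕ) :
    ∫ x, cosBasis i x * cosBasis j x ∂uniformPi = if i = j then 1 else 0 := by
  set ci : ℝ := if i = 0 then 1 else √2 with hci
  set cj : ℝ := if j = 0 then 1 else √2 with hcj
  have h1 : ∫ x, cosBasis i x * cosBasis j x ∂uniformPi = Real.pi⁻¹ *
      ∫ x in (0 : ℝ)..Real.pi, (ci * cj / 2) *
        (Real.cos (((i - j : ℤ) : ℝ) * x) + Real.cos (((i + j : ℤ) : ℝ) * x)) := by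
    rw [uniformPi, integral_smul_measure, intervalIntegral.integral_of_le Real.pi_pos.le,
      ← integral_Icc_eq_integral_Ioc, ENNReal.toReal_inv, ENNReal.toReal_ofReal Real.pi_pos.le,
      smul_eq_mul]
    congr 1
    refine setIntegral_congr_fun measurableSet_Icc fun x hx => ?_
    simp only [cosBasis, Set.indicator_of_mem hx]
    push_cast
    rw [sub_mul, add_mul, Real.cos_sub, Real.cos_add, ← hci, ← hcj]
    ring
  rw [h1, intervalIntegral.integral_const_mul, intervalIntegral.integral_add
    ((by fun_prop : Continuous _).intervalIntegrable _ _)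
    ((by fun_prop : Continuous _).intervalIntegrable _ _), integral_cos_int_mul,
    integral_cos_int_mul]
  have hpi := Real.pi_ne_zero
  have h2 : √2 * √2 = 2 := Real.mul_self_sqrt (by norm_num)
  by_cases hij : i = j
  · subst hij
    by_cases hi : i = 0
    · simp [hci, hcj, hi]
      field_simp
      norm_num
    · have : ((i : ℤ) + i) ≠ 0 := by omega
      simp only [hci, hcj, hi, if_false, sub_self, if_true, this, h2]
      field_simp
      norm_num
  · have h3 : ((i : ℤ) - j) ≠ 0 := by omega
    have h4 : ((i : ℤ) + j) ≠ 0 := by omega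
    simp [h3, h4, hij]

lemma orthonormal_cosBasis :
    Orthonormal ℝ fun j => (memLp_cosBasis j).toLp (cosBasis j) := by
  rw [orthonormal_iff_ite]
  intro i j
  rw [L2_inner_toLp, integral_cosBasis_mul]

/-- Integer frequencies are allowed because the recursion in `indicator_cos_pow_mem_span` can step
below `0`; cosine is even, so only `|m|` matters. -/
lemma indicator_cos_mem_span (m : ℤ) :
    (Set.Icc 0 Real.pi).indicator (fun x => Real.cos (m * x)) ∈
      Submodule.span ℝ (Set.range cosBasis) := by
  set c : ℝ := if m.natAbs = 0 then 1 else √2 with hc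
  have hc0 : c ≠ 0 := by rw [hc]; split_ifs <;> simp
  have : (Set.Icc 0 Real.pi).indicator (fun x => Real.cos (m * x)) =
      c⁻¹ • cosBasis m.natAbs := by
    ext x
    rw [Pi.smul_apply, cosBasis, smul_eq_mul]
    by_cases hx : x ∈ Set.Icc 0 Real.pi
    · rw [Set.indicator_of_mem hx, Set.indicator_of_mem hx, ← hc, inv_mul_cancel_left₀ hc0]
      rcases Int.natAbs_eq m with h | h
      · conv_lhs => rw [h]
        simp
      · conv_lhs => rw [h]
        simp
    · rw [Set.indicator_of_notMem hx, Set.indicator_of_notMem hx, mul_zero]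
  rw [this]
  exact Submodule.smul_mem _ _ (Submodule.subset_span ⟨_, rfl⟩)

/-- Induction on `k` through `2 cos x cos (m x) = cos ((m + 1) x) + cos ((m - 1) x)`, hence for all
`m` at once. -/
lemma indicator_cos_pow_mem_span (k : ℕ) : ∀ m : ℤ,
    (Set.Icc 0 Real.pi).indicator (fun x => Real.cos x ^ k * Real.cos (m * x)) ∈
      Submodule.span ℝ (Set.range cosBasis) := by
  induction k with
  | zero => simpa using indicator_cos_mem_span
  | succ k ih =>
    intro m
    have : (Set.Icc 0 Real.pi).indicator (fun x => Real.cos x ^ (k + 1) * Real.cos (m * x)) =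
        (1 / 2 : ℝ) • ((Set.Icc 0 Real.pi).indicator
            (fun x => Real.cos x ^ k * Real.cos ((m + 1 : ℤ) * x)) +
          (Set.Icc 0 Real.pi).indicator
            (fun x => Real.cos x ^ k * Real.cos ((m - 1 : ℤ) * x))) := by
      ext x
      simp only [Pi.smul_apply, Pi.add_apply, smul_eq_mul]
      by_cases hx : x ∈ Set.Icc 0 Real.pi
      · simp only [Set.indicator_of_mem hx]
        push_cast
        rw [add_mul, sub_mul, one_mul, Real.cos_add, Real.cos_sub]
        ring
      · simp only [Set.indicator_of_notMem hx]
        ring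
    rw [this]
    exact Submodule.smul_mem _ _ (Submodule.add_mem _ (ih _) (ih _))

lemma indicator_polynomial_cos_mem_span (p : Polynomial ℝ) :
    (Set.Icc 0 Real.pi).indicator (fun x => p.eval (Real.cos x)) ∈
      Submodule.span ℝ (Set.range cosBasis) := by
  induction p using Polynomial.induction_on' with
  | add p q hp hq =>
    simp only [Polynomial.eval_add]
    rw [Set.indicator_add]
    exact Submodule.add_mem _ hp hq
  | monomial k a =>
    have : (Set.Icc 0 Real.pi).indicator
          (fun x => (Polynomial.monomial k a).eval (Real.cos x)) =
        a • (Set.Icc 0 Real.pi).indicator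
          (fun x => Real.cos x ^ k * Real.cos ((0 : ℤ) * x)) := by
      ext x
      by_cases hx : x ∈ Set.Icc 0 Real.pi <;> simp [hx]
    rw [this]
    exact Submodule.smul_mem _ _ (indicator_cos_pow_mem_span k 0)

lemma toLp_mem_span_of_mem_span {f : ℝ → ℝ} (hf : f ∈ Submodule.span ℝ (Set.range cosBasis)) :
    ∃ h : MemLp f 2 uniformPi, h.toLp f ∈
      Submodule.span ℝ (Set.range fun j => (memLp_cosBasis j).toLp (cosBasis j)) := by
  induction hf using Submodule.span_induction with
  | mem f hf =>
    obtain ⟨j, rfl⟩ := hf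
    exact ⟨memLp_cosBasis j, Submodule.subset_span ⟨j, rfl⟩⟩
  | zero => exact ⟨MemLp.zero, by rw [MemLp.toLp_zero]; exact Submodule.zero_mem _⟩
  | add f g _ _ hf hg =>
    obtain ⟨hf, hf'⟩ := hf
    obtain ⟨hg, hg'⟩ := hg
    exact ⟨hf.add hg, by rw [MemLp.toLp_add hf hg]; exact Submodule.add_mem _ hf' hg'⟩
  | smul a f _ hf =>
    obtain ⟨hf, hf'⟩ := hf
    exact ⟨hf.const_smul a, by
      rw [MemLp.toLp_const_smul a hf]; exact Submodule.smul_mem _ _ hf'⟩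

/-- Bounded continuous functions are dense in `L²`, and on `[0, π]` the substitution `t = cos x`
reduces their approximation to Weierstrass' theorem on `[-1, 1]`: polynomials in `cos x` lie in the
span. -/
lemma span_cosBasis_dense :
    (Submodule.span ℝ (Set.range fun j =>
      (memLp_cosBasis j).toLp (cosBasis j))).topologicalClosure = ⊤ := by
  rw [eq_top_iff]
  intro F _
  rw [← SetLike.mem_coe, Submodule.topologicalClosure_coe, Metric.mem_closure_iff]
  intro ε hε
  obtain ⟨h, hFh, hh⟩ := (Lp.memLp F).exists_boundedContinuous_eLpNorm_sub_le
    ENNReal.ofNat_ne_top (ε := ENNReal.ofReal (ε / 3)) (by positivity)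
  obtain ⟨p, hp⟩ := exists_polynomial_near_of_continuousOn (-1) 1 (fun t => h (Real.arccos t))
    (h.continuous.comp Real.continuous_arccos).continuousOn (ε / 3) (by positivity)
  set G := (Set.Icc 0 Real.pi).indicator (fun x => p.eval (Real.cos x)) with hG
  obtain ⟨hGL, hGs⟩ := toLp_mem_span_of_mem_span (indicator_polynomial_cos_mem_span p)
  refine ⟨_, hGs, ?_⟩
  have hhG : eLpNorm (⇑h - G) 2 uniformPi ≤ ENNReal.ofReal (ε / 3) := by
    have := eLpNorm_le_of_ae_bound (p := 2) (μ := uniformPi) (f := ⇑h - G) (C := ε / 3) (by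
      filter_upwards [ae_mem_Icc_uniformPi] with x hx
      rw [Pi.sub_apply, hG, Set.indicator_of_mem hx, norm_sub_rev, Real.norm_eq_abs]
      have := hp (Real.cos x) ⟨Real.neg_one_le_cos x, Real.cos_le_one x⟩
      rw [Real.arccos_cos hx.1 hx.2] at this
      exact this.le)
    simpa using this
  have hFG : eLpNorm (⇑F - G) 2 uniformPi ≤ ENNReal.ofReal (2 * (ε / 3)) := by
    have := eLpNorm_add_le ((Lp.aestronglyMeasurable F).sub hh.aestronglyMeasurable)
      (hh.aestronglyMeasurable.sub hGL.aestronglyMeasurable) (p := 2) (by norm_num)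
    rw [sub_add_sub_cancel] at this
    refine this.trans ((add_le_add hFh hhG).trans (le_of_eq ?_))
    rw [two_mul, ENNReal.ofReal_add (by positivity) (by positivity)]
  have h2 : edist F (hGL.toLp G) ≤ ENNReal.ofReal (2 * (ε / 3)) := by
    rw [Lp.edist_def]
    refine le_trans (le_of_eq (eLpNorm_congr_ae ?_)) hFG
    filter_upwards [hGL.coeFn_toLp] with x hx
    rw [Pi.sub_apply, Pi.sub_apply, hx]
  rw [edist_dist, ENNReal.ofReal_le_ofReal_iff (by positivity)] at h2
  linarith

lemma isOrthonormalBasisL2_cosBasis : IsOrthonormalBasisL2 uniformPi cosBasis :=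
  ⟨measurable_cosBasis, memLp_cosBasis, orthonormal_cosBasis, span_cosBasis_dense⟩

lemma hasBoundedKernel_cosBasis {μ : ℕ → ℝ} (h0 : ∀ j, 0 ≤ μ j) (hμ : Summable μ) :
    HasBoundedKernel cosBasis μ := by
  have hle : ∀ x j, μ j * cosBasis j x * cosBasis j x ≤ 2 * μ j := fun x j => by
    rw [mul_assoc, mul_comm]
    exact mul_le_mul_of_nonneg_right (cosBasis_sq_le j x) (h0 j)
  have hnn : 0 ≤ ∑' j, μ j := tsum_nonneg h0
  -- The bound comes from `φ_j² ≤ 2`; the summand `1` keeps `κ` positive when `μ = 0`.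
  refine ⟨√(2 * ∑' j, μ j + 1), Real.sqrt_pos.2 (by positivity), fun x => ?_⟩
  have hs : Summable fun j => μ j * cosBasis j x * cosBasis j x :=
    Summable.of_nonneg_of_le (fun j => by
      rw [mul_assoc]; exact mul_nonneg (h0 j) (mul_self_nonneg _)) (hle x) (hμ.mul_left 2)
  refine ⟨hs, ?_⟩
  rw [Real.sq_sqrt (by positivity), ← tsum_mul_left]
  exact (hs.tsum_le_tsum (hle x) (hμ.mul_left 2)).trans (by linarith)

/-! ### The source distribution. -/

/-- The source distribution: the target with weight `1 / B`, the rest of the mass at a point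
outside the support of the target. -/
noncomputable def sourceMeasure (B : ℝ) : Measure ℝ :=
  ENNReal.ofReal (1 / B) • uniformPi + ENNReal.ofReal (1 - 1 / B) • Measure.dirac (-1)

lemma isProbabilityMeasure_sourceMeasure {B : ℝ} (hB : 1 ≤ B) :
    IsProbabilityMeasure (sourceMeasure B) where
  measure_univ := by
    have h1 : 1 / B ≤ 1 := by rw [div_le_one (by linarith)]; exact hB
    simp only [sourceMeasure, Measure.add_apply, Measure.smul_apply, measure_univ, smul_eq_mul,
      mul_one]
    rw [← ENNReal.ofReal_add (by positivity) (by linarith)]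
    simp

/-- On `[0, π]` the source is the target divided by `B`, so the density is `B` there and `0`
elsewhere, in particular at the atom. -/
lemma boundedLikelihoodRatio_sourceMeasure {B : ℝ} (hB : 1 ≤ B) :
    BoundedLikelihoodRatio (sourceMeasure B) uniformPi B := by
  have hB0 : 0 < B := by linarith
  refine ⟨(Set.Icc 0 Real.pi).indicator fun _ => ENNReal.ofReal B,
    measurable_const.indicator measurableSet_Icc, ?_, fun x => ?_⟩
  · have hnot : (-1 : ℝ) ∉ Set.Icc 0 Real.pi := fun h => by
      have := h.1
      linarith
    have hres : uniformPi.restrict (Set.Icc 0 Real.pi) = uniformPi :=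
      Measure.restrict_eq_self_of_ae_mem ae_mem_Icc_uniformPi
    rw [withDensity_indicator measurableSet_Icc, withDensity_const, sourceMeasure,
      Measure.restrict_add, Measure.restrict_smul, Measure.restrict_smul, hres,
      restrict_dirac' measurableSet_Icc, if_neg hnot, smul_zero, add_zero, smul_smul,
      ← ENNReal.ofReal_mul hB0.le, mul_one_div_cancel hB0.ne', ENNReal.ofReal_one, one_smul]
  · exact Set.indicator_le_self' (fun _ _ => zero_le) x

/-- The atom contributes nothing because the basis is extended by zero. This is the only property of
the source, besides being a probability measure, that the lower bound uses. -/
lemma lintegral_cosBasis_sq_sourceMeasure (B : ℝ) (j : ℕ) :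
    ∫⁻ x, ENNReal.ofReal (cosBasis j x ^ 2) ∂sourceMeasure B ≤ ENNReal.ofReal (1 / B) := by
  have hz : cosBasis j (-1) = 0 :=
    Set.indicator_of_notMem (fun h => by have := h.1; linarith) _
  have h1 : ∫⁻ x, ENNReal.ofReal (cosBasis j x ^ 2) ∂uniformPi = 1 := by
    rw [← ofReal_norm_toLp_sq (memLp_cosBasis j), orthonormal_cosBasis.1 j]
    simp
  rw [sourceMeasure, lintegral_add_measure, lintegral_smul_measure, lintegral_smul_measure, h1,
    lintegral_dirac, hz]
  simp

end CovariateShift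

theorem theorem2 :
    ∃ c : ℝ, 0 < c ∧
      ∀ B : ℝ, 1 ≤ B →
        ∃ (X : Type) (_ : MeasurableSpace X) (P Q : Measure X) (φ : ℕ → X → ℝ),
          IsProbabilityMeasure P ∧ IsProbabilityMeasure Q ∧
          CovariateShift.BoundedLikelihoodRatio P Q B ∧
          CovariateShift.IsOrthonormalBasisL2 Q φ ∧
          ∀ μ : ℕ → ℝ, CovariateShift.IsRegular μ →
            CovariateShift.HasBoundedKernel φ μ ∧
            ∀ (n : ℕ) (σ : ℝ≥0), 1 ≤ n → 0 < σ →
              (∃ j, (σ : ℝ) ^ 2 * B / n ≤ μ j) →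
              ENNReal.ofReal (c * ⨅ δ : Set.Ioi (0 : ℝ),
                  ((δ : ℝ) ^ 2 + (σ : ℝ) ^ 2 * B * (CovariateShift.statDim μ δ / n)))
                ≤ CovariateShift.minimaxRisk P Q σ n (CovariateShift.unitBall φ μ) := by
  refine ⟨1 / 16, by norm_num, fun B hB => ?_⟩
  have := CovariateShift.isProbabilityMeasure_sourceMeasure hB
  refine ⟨ℝ, inferInstance, CovariateShift.sourceMeasure B, CovariateShift.uniformPi,
    CovariateShift.cosBasis, this, inferInstance,
    CovariateShift.boundedLikelihoodRatio_sourceMeasure hB,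
    CovariateShift.isOrthonormalBasisL2_cosBasis, fun μ hμ =>
      ⟨CovariateShift.hasBoundedKernel_cosBasis hμ.1 hμ.2.1, fun n σ hn hσ hj => ?_⟩⟩
  exact CovariateShift.le_minimaxRisk (by linarith) CovariateShift.isOrthonormalBasisL2_cosBasis
    (CovariateShift.lintegral_cosBasis_sq_sourceMeasure B) hn hσ hj
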